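/- Let $g:\mathbb N\to\mathbb R$ be a nonnegative function, where $\mathbb N$ denotes the positive integers. For a finite connected graph $G$ put \[ W(G;g)=\sum_{\{u,v\}\subseteq V(G),\,u\neq v} g(d(u,v)), \] where $d(u,v)$ is the distance in $G$. The eccentricity of a vertex $v$ is $\max_u d(v,u)$. A finite tree $T$ is said to have eccentric sequence $S=(r;m_2,m_3,\ldots,m_l)$ if the different eccentricities of its vertices are $b_1<b_2<\cdots<b_l$, where $b_1=r$ and, for $2\le j\le l$, exactly $m_j$ vertices of $T$ have eccentricity $b_j$. Let $\mathbf T(r;m_2,\ldots,m_l)$ be the caterpillar obtained from the path $v_0,v_1,\ldots,v_{r+l-1}$ by attaching $m_j-2$ pendent edges to the vertex $v_{l+1-j}$ for each $2\le j\le l$. Let $T$ be a finite tree with eccentric sequence $S=(r;m_2,m_3,\ldots,m_l)$. (a) If $g$ is nondecreasing, then \[ W(T;g)\ \ge\ W(\mathbf T(r;m_2,\ldots,m_l);g). \] If, in addition, $g$ is strictly increasing, then equality holds if and only if $T$ is isomorphic to $\mathbf T(r;m_2,\ldots,m_l)$. (b) If $g$ is nonincreasing, then \[ W(T;g)\ \le\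 W(\mathbf T(r;m_2,\ldots,m_l);g). \] If, in addition, $g$ is strictly decreasing, then equality holds if and only if $T$ is isomorphic to $\mathbf T(r;m_2,\ldots,m_l)$. -/

import Mathlib

namespace EccTree

/-- The Wiener-type index `W(G; g)`: the sum of `g (d(u, v))` over all unordered pairs `{u, v}` of
distinct vertices of `G`. Only the values of `g` at positive integers occur when `G` is
connected. -/
noncomputable def wienerType {V : Type*} [Fintype V] (G : SimpleGraph V) (g : ℕ → ℝ) : ℝ :=
  open Classical in
  ∑ e : Sym2 V with ¬ e.IsDiag,
    e.lift ⟨fun u v => g (G.dist u v), fun _ _ => congrArg g G.dist_comm⟩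

/-- `G` has eccentric sequence `(r; m_2, …, m_l)`: the different eccentricities of `G`, listed in
increasing order, are `b_1 < b_2 < ⋯ < b_l`, where `b_1 = r`, and for `2 ≤ j ≤ l` exactly
`m j` vertices have eccentricity `b_j`. (Values `m j` with `j ∉ [2, l]` play no role.) -/
def HasEccSeq {V : Type*} (G : SimpleGraph V) (r l : ℕ) (m : ℕ → ℕ) : Prop :=
  ∃ b : ℕ → ℕ, StrictMonoOn b (Set.Icc 1 l) ∧
    (fun j => (b j : ℕ∞)) '' Set.Icc 1 l = Set.range G.eccent ∧
    b 1 = r ∧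
    ∀ j ∈ Set.Icc 2 l, {v : V | G.eccent v = b j}.ncard = m j

/-- The vertices of `𝐓(r; m_2, …, m_l)`: the `r + l` vertices `v_0, …, v_{r+l-1}` of the path, and
`m j - 2` additional vertices for each `2 ≤ j ≤ l`. -/
abbrev StdVertex (r l : ℕ) (m : ℕ → ℕ) : Type :=
  Fin (r + l) ⊕ (Σ j : Finset.Icc 2 l, Fin (m j - 2))

/-- The caterpillar `𝐓(r; m_2, …, m_l)`, obtained from the path `v_0, …, v_{r+l-1}` by attaching
`m j - 2` pendent edges to `v_{l+1-j}` for all `2 ≤ j ≤ l` (it is used for `m j ≥ 2`). -/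
def stdCaterpillar (r l : ℕ) (m : ℕ → ℕ) : SimpleGraph (StdVertex r l m) where
  Adj x y := match x, y with
    | .inl a, .inl b => (SimpleGraph.pathGraph (r + l)).Adj a b
    | .inl a, .inr p => (a : ℕ) = l + 1 - p.1
    | .inr p, .inl a => (a : ℕ) = l + 1 - p.1
    | .inr _, .inr _ => False
  symm := ⟨by
    rintro (a | p) (b | q) h
    · exact SimpleGraph.Adj.symm h
    · exact h
    · exact h
    · exact h⟩
  loopless := ⟨by
    rintro (a | p) h
    · exact SimpleGraph.irrefl _ h
    · exact h⟩

end EccTree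

/-! Fix a diametral path `x 0, …, x D` of the tree. A vertex at height `h` over its projection `x a`
has eccentricity `h + max a (D - a)`, so the eccentricities fill the interval from `⌈D/2⌉` to `D`;
hence `D = r + l - 1`. The path has exactly two vertices of each eccentricity above `r`, leaving `m
j - 2` others, none of eccentricity `r`. Off-path vertices can thus be matched with pendent vertices
of equal eccentricity: with `s = min a (D - a)`, the partner hangs at index `s + 1 - h`.

Under this matching, let `g` be nondecreasing. Path-path distances agree, after folding `a` to `s`,
path-to-off-path distances do not grow in the caterpillar, and neither do off-path distances, except
when `q'` lies between `q` and the path. Then the tree distance is `h - h'` and the caterpillar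
distance `h - h' + 2`. This loss is paid for by the pair of `q` and the path index `s - h'`, whose
distance drops from `h + h'` to `h - h'`; different `q'` below the same `q` use different indices
(`sum_dist_comparison`). The index `s - h` is never used and contributes `g (2h) - g 2`, so for
strict `g` equality forces `h = 1`. It then also forces all pendent vertices onto one side of the
path, up to reflection. The nonincreasing case follows by passing to `-g`. -/

namespace EccTree

/-! ### Geodesics in a tree and projections onto them. -/

variable {V : Type*} {G : SimpleGraph V}

/-- The sequence `x 0, …, x n` is a geodesic of `G`. -/
def IsGeodesicSeq (G : SimpleGraph V) (x : ℕ → V) (n : ℕ) : Prop :=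
  ∀ i j, i ≤ j → j ≤ n → i + G.dist (x i) (x j) = j

theorem IsGeodesicSeq.adj {x : ℕ → V} {n i : ℕ} (hx : IsGeodesicSeq G x n) (hi : i + 1 ≤ n) :
    G.Adj (x i) (x (i + 1)) := by
  rw [← SimpleGraph.dist_eq_one_iff_adj]
  have := hx i (i + 1) (by omega) hi
  omega

theorem exists_isGeodesicSeq (hG : G.Connected) (u w : V) :
    ∃ x : ℕ → V, x 0 = u ∧ x (G.dist u w) = w ∧ IsGeodesicSeq G x (G.dist u w) := by
  obtain ⟨p, hp⟩ := hG.exists_walk_length_eq_dist u w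
  refine ⟨p.getVert, p.getVert_zero, by rw [← hp]; exact p.getVert_length, ?_⟩
  have hle : ∀ i d, i + d ≤ p.length → G.dist (p.getVert i) (p.getVert (i + d)) ≤ d := by
    intro i d
    induction d with
    | zero => simp
    | succ d ih =>
      intro h
      have h1 := ih (by omega)
      have h2 : G.dist (p.getVert (i + d)) (p.getVert (i + (d + 1))) = 1 :=
        SimpleGraph.dist_eq_one_iff_adj.2 (p.adj_getVert_succ (by omega))
      have h3 := hG.dist_triangle (u := p.getVert i) (v := p.getVert (i + d))
        (w := p.getVert (i + (d + 1)))
      omega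
  intro i j hij hj
  have h1 := hle 0 i (by omega)
  have h2 := hle i (j - i) (by omega)
  have h3 := hle j (p.length - j) (by omega)
  rw [show i + (j - i) = j by omega] at h2
  rw [show j + (p.length - j) = p.length by omega, p.getVert_length] at h3
  rw [Nat.zero_add, p.getVert_zero] at h1
  have h4 := hG.dist_triangle (u := u) (v := p.getVert i) (w := w)
  have h5 := hG.dist_triangle (u := p.getVert i) (v := p.getVert j) (w := w)
  omega

/-- In a tree, a vertex between `w` and `z` is determined by its distance to `w`. -/
theorem eq_of_dist_eq_of_between (hG : G.IsTree) {w z u₁ u₂ : V}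
    (h₁ : G.dist w u₁ + G.dist u₁ z = G.dist w z) (h₂ : G.dist w u₂ + G.dist u₂ z = G.dist w z)
    (h : G.dist w u₁ = G.dist w u₂) : u₁ = u₂ := by
  have key : ∀ u, G.dist w u + G.dist u z = G.dist w z →
      ∃ p : G.Path w z, (p : G.Walk w z).getVert (G.dist w u) = u := by
    intro u hu
    obtain ⟨p, hp⟩ := hG.connected.exists_walk_length_eq_dist w u
    obtain ⟨q, hq⟩ := hG.connected.exists_walk_length_eq_dist u z
    have hpq : (p.append q).length = G.dist w z := by
      rw [SimpleGraph.Walk.length_append, hp, hq, hu]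
    refine ⟨⟨p.append q, SimpleGraph.Walk.isPath_of_length_eq_dist _ hpq⟩, ?_⟩
    simp [SimpleGraph.Walk.getVert_append, ← hp]
  obtain ⟨p₁, hp₁⟩ := key u₁ h₁
  obtain ⟨p₂, hp₂⟩ := key u₂ h₂
  rw [← hp₁, ← hp₂, (hG.isAcyclic.subsingleton_path w z).elim p₁ p₂, h]

/-- `a` is the index of the projection of `w` onto the geodesic `x 0, …, x n`. -/
def IsProj (G : SimpleGraph V) (x : ℕ → V) (n : ℕ) (w : V) (a : ℕ) : Prop :=
  a ≤ n ∧ ∀ k, k ≤ n → (k ≤ a → G.dist w (x k) + k = G.dist w (x a) + a) ∧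
    (a ≤ k → G.dist w (x k) + a = G.dist w (x a) + k)

/-- Along a geodesic the distance to `w` changes by exactly one at each step and never rises and
then falls, so it descends to a single minimum and then ascends. -/
theorem exists_isProj (hG : G.IsTree) {x : ℕ → V} {n : ℕ} (hx : IsGeodesicSeq G x n) (w : V) :
    ∃ a, IsProj G x n w a := by
  have hstep : ∀ k, k + 1 ≤ n → G.dist w (x k) = G.dist w (x (k + 1)) + 1 ∨
      G.dist w (x (k + 1)) = G.dist w (x k) + 1 := fun k hk =>
    hG.dist_eq_dist_add_one_of_adj w (hx.adj hk)
  -- At a peak, both neighbours of `x (k + 1)` would lie between it and `w` at equal distance from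
  -- `w`, hence coincide.
  have hpeak : ∀ k, k + 2 ≤ n → G.dist w (x (k + 1)) = G.dist w (x k) + 1 →
      G.dist w (x (k + 2)) = G.dist w (x (k + 1)) + 1 := by
    intro k hk h
    rcases hstep (k + 1) hk with h' | h'
    · exfalso
      have e1 : G.dist (x k) (x (k + 1)) = 1 :=
        SimpleGraph.dist_eq_one_iff_adj.2 (hx.adj (by omega))
      have e2 : G.dist (x (k + 2)) (x (k + 1)) = 1 :=
        SimpleGraph.dist_eq_one_iff_adj.2 (hx.adj hk).symm
      have h3 := hx k (k + 2) (by omega) hk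
      have h4 : G.dist w (x (k + 1)) = G.dist w (x (k + 2)) + 1 := h'
      have : x k = x (k + 2) := eq_of_dist_eq_of_between hG (w := w) (z := x (k + 1))
        (by omega) (by omega) (by omega)
      rw [this, SimpleGraph.dist_self] at h3
      omega
    · exact h'
  by_cases hex : ∃ a, a + 1 ≤ n ∧ G.dist w (x (a + 1)) = G.dist w (x a) + 1
  · classical
    have hspec := Nat.find_spec hex
    have hmin := fun k => Nat.find_min hex (m := k)
    set a := Nat.find hex
    have hdown : ∀ d, d ≤ a → G.dist w (x (a - d)) = G.dist w (x a) + d := by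
      intro d
      induction d with
      | zero => simp
      | succ d ih =>
        intro hd
        have h1 := ih (by omega)
        have h2 := hmin (a - (d + 1)) (by omega)
        have h3 := hstep (a - (d + 1)) (by omega)
        rw [show a - (d + 1) + 1 = a - d by omega] at h2 h3
        omega
    have hup : ∀ d, a + d + 1 ≤ n → G.dist w (x (a + d + 1)) = G.dist w (x (a + d)) + 1 := by
      intro d
      induction d with
      | zero => exact fun _ => hspec.2
      | succ d ih => exact fun hd => hpeak (a + d) hd (ih (by omega))
    have hup' : ∀ d, a + d ≤ n → G.dist w (x (a + d)) = G.dist w (x a) + d := by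
      intro d
      induction d with
      | zero => simp
      | succ d ih =>
        intro hd
        have h1 := ih (by omega)
        have h2 := hup d hd
        rw [show a + (d + 1) = a + d + 1 by omega]
        omega
    refine ⟨a, by omega, fun k hk => ⟨fun h => ?_, fun h => ?_⟩⟩
    · have := hdown (a - k) (by omega)
      rw [show a - (a - k) = k by omega] at this
      omega
    · have := hup' (k - a) (by omega)
      rw [show a + (k - a) = k by omega] at this
      omega
  · push Not at hex
    have hdown : ∀ d, d ≤ n → G.dist w (x (n - d)) = G.dist w (x n) + d := by
      intro d
      induction d with
      | zero => simp
      | succ d ih =>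
        intro hd
        have h1 := ih (by omega)
        have h2 := hex (n - (d + 1)) (by omega)
        have h3 := hstep (n - (d + 1)) (by omega)
        rw [show n - (d + 1) + 1 = n - d by omega] at h2 h3
        omega
    refine ⟨n, le_rfl, fun k hk => ⟨fun h => ?_, fun h => ?_⟩⟩
    · have := hdown (n - k) (by omega)
      rw [show n - (n - k) = k by omega] at this
      omega
    · rw [show k = n by omega]

/-- Projecting `u` to the geodesic from `v` to `w` shows that the sum is twice the height of `u`
plus twice `d(v, w)`. -/
theorem even_dist_add_dist_add_dist (hG : G.IsTree) (u v w : V) :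
    Even (G.dist u v + G.dist u w + G.dist v w) := by
  obtain ⟨x, hx0, hxn, hx⟩ := exists_isGeodesicSeq hG.connected v w
  obtain ⟨a, ha, h⟩ := exists_isProj hG hx u
  have h0 := (h 0 (Nat.zero_le _)).1 (Nat.zero_le _)
  have hn := (h _ le_rfl).2 ha
  rw [hx0] at h0
  rw [hxn] at hn
  exact ⟨G.dist u (x a) + G.dist v w, by omega⟩

theorem dist_eq_of_isProj_lt (hG : G.IsTree) {x : ℕ → V} {n : ℕ} (hx : IsGeodesicSeq G x n)
    {w w' : V} {a a' : ℕ} (ha : IsProj G x n w a) (ha' : IsProj G x n w' a') (hlt : a < a') :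
    G.dist w w' + a = G.dist w (x a) + G.dist w' (x a') + a' := by
  obtain ⟨y, hy0, hyn, hy⟩ := exists_isGeodesicSeq hG.connected w (x n)
  obtain ⟨b, hb, hbk⟩ := exists_isProj hG hy w'
  have han := (ha.2 n le_rfl).2 ha.1
  have hle := ha.1
  have hle' := ha'.1
  -- From `x a` on, the geodesic `y` from `w` to `x n` runs along `x`. As `w'` gets closer from `x
  -- a` to `x (a + 1)`, its projection to `y` lies beyond `x a`, so its distance to `w` is that to
  -- `x a` plus the height of `w`.
  have hyx : ∀ k, a ≤ k → k ≤ n → y (G.dist w (x a) + k - a) = x k := by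
    intro k hk hkn
    have h1 := (ha.2 k hkn).2 hk
    have h2 := hx k n hkn le_rfl
    have h3 := hy 0 (G.dist w (x a) + k - a) (by omega) (by omega)
    have h4 := hy (G.dist w (x a) + k - a) _ (by omega) le_rfl
    rw [hy0] at h3
    rw [hyn] at h4
    exact eq_of_dist_eq_of_between hG (w := w) (z := x n) (by omega) (by omega) (by omega)
  have e0 := hbk 0 (Nat.zero_le _)
  have e1 := hbk (G.dist w (x a) + a - a) (by omega)
  have e2 := hbk (G.dist w (x a) + (a + 1) - a) (by omega)
  rw [hyx a le_rfl hle] at e1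
  rw [hyx (a + 1) (by omega) (by omega)] at e2
  have e3 := hbk (G.dist w (x a) + a' - a) (by omega)
  rw [hyx a' (by omega) hle'] at e3
  have f1 := ha'.2 a (by omega)
  have f2 := ha'.2 (a + 1) (by omega)
  rw [hy0, SimpleGraph.dist_comm] at e0
  omega

end EccTree

/-! ### The index as a double sum, and distances in the caterpillar. -/

namespace EccTree

theorem wienerType_eq_sum_lt {V : Type*} [Fintype V] [LinearOrder V] (G : SimpleGraph V)
    (g : ℕ → ℝ) :
    wienerType G g = ∑ p : V × V with p.1 < p.2, g (G.dist p.1 p.2) := by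
  classical
  have h := Finset.sum_sym2_filter_not_isDiag (Finset.univ : Finset V)
    (fun e => e.lift ⟨fun u v => g (G.dist u v), fun _ _ => congrArg g G.dist_comm⟩)
  rw [Finset.sym2_univ] at h
  unfold wienerType
  convert h using 1
  · refine Finset.sum_congr ?_ fun _ _ => rfl
    ext e
    simp only [Finset.mem_filter, Finset.mem_univ, true_and]
  refine Finset.sum_congr ?_ fun _ _ => rfl
  ext p
  simp only [Finset.mem_filter, Finset.mem_univ, true_and, Finset.mem_offDiag]
  exact ⟨fun h => ⟨h.ne, h⟩, fun h => h.2⟩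

open Classical in
theorem two_mul_wienerType {V : Type*} [Fintype V] (G : SimpleGraph V) (g : ℕ → ℝ) :
    2 * wienerType G g = ∑ u, ∑ v, if u = v then 0 else g (G.dist u v) := by
  let _ : LinearOrder V := LinearOrder.lift' (Fintype.equivFin V) (Fintype.equivFin V).injective
  have hswap : ∑ p : V × V with p.1 < p.2, g (G.dist p.1 p.2) =
      ∑ p : V × V with p.2 < p.1, g (G.dist p.1 p.2) := by
    refine Finset.sum_equiv (Equiv.prodComm V V) (by simp) fun p _ => ?_
    simp [G.dist_comm]
  rw [two_mul]
  nth_rw 2 [wienerType_eq_sum_lt]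
  rw [wienerType_eq_sum_lt, hswap, ← hswap, ← Fintype.sum_prod_type']
  nth_rw 2 [hswap]
  rw [Finset.sum_filter, Finset.sum_filter, ← Finset.sum_add_distrib]
  refine Finset.sum_congr rfl fun p _ => ?_
  rcases lt_trichotomy p.1 p.2 with h | h | h
  · simp [h, h.ne, h.not_gt]
  · simp [h]
  · simp [h, h.ne', h.not_gt]

open Classical in
theorem two_mul_wienerType_of_equiv {V W : Type*} [Fintype V] [Fintype W] (G : SimpleGraph V)
    (g : ℕ → ℝ) (ψ : W ≃ V) :
    2 * wienerType G g = ∑ x, ∑ y, if x = y then 0 else g (G.dist (ψ x) (ψ y)) := by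
  rw [two_mul_wienerType, ← Equiv.sum_comp ψ]
  refine Finset.sum_congr rfl fun x _ => ?_
  rw [← Equiv.sum_comp ψ]
  simp

theorem wienerType_neg {V : Type*} [Fintype V] (G : SimpleGraph V) (g : ℕ → ℝ) :
    wienerType G (fun n => -g n) = -wienerType G g := by
  unfold wienerType
  rw [← Finset.sum_neg_distrib]
  refine Finset.sum_congr rfl fun e _ => ?_
  induction e with
  | _ u v => rfl

/-- Descending along `d x` builds a walk of length `d x y`; growth by at most one per edge makes it
shortest. -/
theorem dist_eq_of_forall {V : Type*} {G : SimpleGraph V} {d : V → V → ℕ}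
    (h0 : ∀ x y, d x y = 0 ↔ x = y) (h1 : ∀ x y z, G.Adj y z → d x z ≤ d x y + 1)
    (h2 : ∀ x y, 0 < d x y → ∃ z, G.Adj z y ∧ d x z + 1 = d x y) (x y : V) :
    G.dist x y = d x y := by
  have hw : ∀ n y, d x y = n → ∃ p : G.Walk x y, p.length = n := by
    intro n
    induction n with
    | zero =>
      intro y hy
      obtain rfl := (h0 x y).1 hy
      exact ⟨.nil, rfl⟩
    | succ n ih =>
      intro y hy
      obtain ⟨z, hz, hd⟩ := h2 x y (by omega)
      obtain ⟨p, hp⟩ := ih z (by omega)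
      exact ⟨p.concat hz, by rw [SimpleGraph.Walk.length_concat, hp]⟩
  have hle : ∀ u v (p : G.Walk u v), d x v ≤ d x u + p.length := by
    intro u v p
    induction p with
    | nil => simp
    | cons h p ih =>
      have := h1 x _ _ h
      rw [SimpleGraph.Walk.length_cons]
      omega
  obtain ⟨p, hp⟩ := hw _ y rfl
  obtain ⟨q, hq⟩ := p.reachable.exists_walk_length_eq_dist
  have h3 := hle x y q
  have h4 := G.dist_le p
  have h5 := (h0 x x).2 rfl
  omega

variable {r l : ℕ} {m : ℕ → ℕ}

/-- The index of the path vertex to which a pendent vertex is attached. -/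
def attach (q : Σ j : Finset.Icc 2 l, Fin (m j - 2)) : ℕ := l + 1 - q.1

open Classical in
/-- The distance of the caterpillar. -/
noncomputable def catDist : StdVertex r l m → StdVertex r l m → ℕ
  | .inl a, .inl b => (a - b : ℕ) + (b - a : ℕ)
  | .inl a, .inr q => 1 + ((a - attach q : ℕ) + (attach q - a : ℕ))
  | .inr q, .inl a => 1 + ((a - attach q : ℕ) + (attach q - a : ℕ))
  | .inr p, .inr q => if p = q then 0 else
      2 + ((attach p - attach q) + (attach q - attach p))

theorem attach_lt (q : Σ j : Finset.Icc 2 l, Fin (m j - 2)) : attach q < r + l := by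
  have := Finset.mem_Icc.1 q.1.2
  unfold attach
  omega

theorem stdCaterpillar_adj_inl {a b : Fin (r + l)} :
    (stdCaterpillar r l m).Adj (.inl a) (.inl b) ↔ (a : ℕ) + 1 = b ∨ (b : ℕ) + 1 = a :=
  SimpleGraph.pathGraph_adj

theorem stdCaterpillar_adj_inl_inr {a : Fin (r + l)} {q} :
    (stdCaterpillar r l m).Adj (.inl a) (.inr q) ↔ (a : ℕ) = attach q := Iff.rfl

theorem stdCaterpillar_adj_inr_inl {a : Fin (r + l)} {q} :
    (stdCaterpillar r l m).Adj (.inr q) (.inl a) ↔ (a : ℕ) = attach q := Iff.rfl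

theorem stdCaterpillar_adj_inr {p q} :
    ¬ (stdCaterpillar r l m).Adj (.inr p) (.inr q) := id

theorem dist_stdCaterpillar (x y : StdVertex r l m) :
    (stdCaterpillar r l m).dist x y = catDist x y := by
  refine dist_eq_of_forall ?_ ?_ ?_ x y
  · rintro (a | p) (b | q)
    · simp only [catDist, Sum.inl.injEq, Fin.ext_iff]
      omega
    · simp [catDist]
    · simp [catDist]
    · simp only [catDist, Sum.inr.injEq]
      split_ifs with h <;> simp [h]
  · rintro (a | p) (b | q) (c | s) h
    · rw [stdCaterpillar_adj_inl] at h
      simp only [catDist]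
      omega
    · rw [stdCaterpillar_adj_inl_inr] at h
      simp only [catDist]
      omega
    · rw [stdCaterpillar_adj_inr_inl] at h
      simp only [catDist]
      omega
    · exact absurd h stdCaterpillar_adj_inr
    · rw [stdCaterpillar_adj_inl] at h
      simp only [catDist]
      omega
    · rw [stdCaterpillar_adj_inl_inr] at h
      simp only [catDist]
      split_ifs <;> omega
    · rw [stdCaterpillar_adj_inr_inl] at h
      simp only [catDist]
      split_ifs with hpq
      · subst hpq
        omega
      · omega
    · exact absurd h stdCaterpillar_adj_inr
  · have toward : ∀ (t : ℕ) (b : Fin (r + l)), t < r + l → t ≠ b → ∃ c : Fin (r + l),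
        ((c : ℕ) + 1 = b ∨ (b : ℕ) + 1 = c) ∧
          (t - c : ℕ) + (c - t : ℕ) + 1 = (t - b : ℕ) + (b - t : ℕ) := by
      intro t b ht hb
      rcases Nat.lt_or_gt_of_ne hb with h | h
      · exact ⟨⟨b - 1, by omega⟩, by dsimp only; omega, by dsimp only; omega⟩
      · exact ⟨⟨b + 1, by omega⟩, by dsimp only; omega, by dsimp only; omega⟩
    rintro (a | p) (b | q) h
    · simp only [catDist] at h
      obtain ⟨c, hc, hd⟩ := toward a b a.2 (by omega)
      exact ⟨.inl c, stdCaterpillar_adj_inl.2 hc, hd⟩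
    · exact ⟨.inl ⟨attach q, attach_lt q⟩, rfl, by simp only [catDist]; omega⟩
    · by_cases hb : attach p = b
      · refine ⟨.inr p, hb.symm, ?_⟩
        simp only [catDist, if_true]
        omega
      · obtain ⟨c, hc, hd⟩ := toward (attach p) b (attach_lt p) hb
        refine ⟨.inl c, stdCaterpillar_adj_inl.2 hc, ?_⟩
        simp only [catDist]
        omega
    · refine ⟨.inl ⟨attach q, attach_lt q⟩, rfl, ?_⟩
      simp only [catDist] at h ⊢
      split_ifs at h ⊢ <;> omega

end EccTree

/-! ### The numerical comparison with the compensation argument. -/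

namespace EccTree

section Comparison

variable {ι : Type*} [Fintype ι] [DecidableEq ι]

/-- Off-path vertices `q` of a tree with a path `0, …, D` are described by the index `s q` of their
projection to the path and their distance `h q` to it; `δ` is their mutual distance. The sum of
`g` over the corresponding distances is compared with the one where `q` is a pendent vertex
attached at `s q + 1 - h q`. -/
theorem sum_dist_comparison (D : ℕ) (s h : ι → ℕ) (δ : ι → ι → ℕ) (g : ℕ → ℝ)
    (hg : MonotoneOn g (Set.Ici 1)) (hpos : ∀ q, 1 ≤ h q) (hhs : ∀ q, h q ≤ s q)
    (hsD : ∀ q, s q ≤ D) (hsymm : ∀ q q', δ q q' = δ q' q)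
    (hδ : ∀ q q', q ≠ q' →
      2 + ((s q + 1 - h q - (s q' + 1 - h q')) + (s q' + 1 - h q' - (s q + 1 - h q))) ≤ δ q q' ∨
      (s q = s q' ∧ h q ≠ h q' ∧ δ q q' = (h q - h q') + (h q' - h q)))
    (huniq : ∀ q q' q'', s q' = s q → s q'' = s q → h q' = h q'' → h q' < h q →
      δ q q' = h q - h q' → δ q q'' = h q - h q' → q' = q'') :
    0 ≤ 2 * (∑ q, ∑ k ∈ Finset.range (D + 1), (g (h q + ((k - s q) + (s q - k))) -
        g (1 + ((k - (s q + 1 - h q)) + (s q + 1 - h q - k))))) +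
      ∑ q, ∑ q', (if q = q' then 0 else g (δ q q') -
        g (2 + ((s q + 1 - h q - (s q' + 1 - h q')) + (s q' + 1 - h q' - (s q + 1 - h q))))) ∧
    (StrictMonoOn g (Set.Ici 1) →
      2 * (∑ q, ∑ k ∈ Finset.range (D + 1), (g (h q + ((k - s q) + (s q - k))) -
        g (1 + ((k - (s q + 1 - h q)) + (s q + 1 - h q - k))))) +
      ∑ q, ∑ q', (if q = q' then 0 else g (δ q q') -
        g (2 + ((s q + 1 - h q - (s q' + 1 - h q')) +
          (s q' + 1 - h q' - (s q + 1 - h q))))) = 0 →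
      (∀ q, h q = 1) ∧ ∀ q q', q ≠ q' → δ q q' = 2 + ((s q - s q') + (s q' - s q))) := by
  classical
  set Δ₁ : ι → ℕ → ℝ := fun q k => g (h q + ((k - s q) + (s q - k))) -
        g (1 + ((k - (s q + 1 - h q)) + (s q + 1 - h q - k))) with hΔ₁
  set Δ₂ : ι → ι → ℝ := fun q q' => if q = q' then 0 else g (δ q q') -
        g (2 + ((s q + 1 - h q - (s q' + 1 - h q')) + (s q' + 1 - h q' - (s q + 1 - h q))))
    with hΔ₂
  change 0 ≤ 2 * (∑ q, ∑ k ∈ Finset.range (D + 1), Δ₁ q k) + ∑ q, ∑ q', Δ₂ q q' ∧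
    (_ → 2 * (∑ q, ∑ k ∈ Finset.range (D + 1), Δ₁ q k) + ∑ q, ∑ q', Δ₂ q q' = 0 → _)
  have hmono : ∀ x y, 1 ≤ x → x ≤ y → g x ≤ g y := fun x y hx hxy =>
    hg (Set.mem_Ici.2 hx) (Set.mem_Ici.2 (hx.trans hxy)) hxy
  -- `anc q q'` says that `q'` lies between `q` and its projection to the path; only these pairs can
  -- get farther apart in the caterpillar.
  let anc : ι → ι → Prop := fun q q' => h q' < h q ∧ s q' = s q ∧ δ q q' = h q - h q'
  have hnonneg₁ : ∀ q k, 0 ≤ Δ₁ q k := by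
    intro q k
    have := hpos q
    have := hhs q
    exact sub_nonneg.2 (hmono _ _ (by omega) (by omega))
  have hsymm₂ : ∀ q q', Δ₂ q q' = Δ₂ q' q := by
    intro q q'
    simp only [hΔ₂, eq_comm (a := q) (b := q'), hsymm q q']
    rw [Nat.add_comm (s q + 1 - h q - (s q' + 1 - h q'))]
  have hnonanc : ∀ q q', q ≠ q' → ¬ anc q q' → ¬ anc q' q →
      2 + ((s q + 1 - h q - (s q' + 1 - h q')) + (s q' + 1 - h q' - (s q + 1 - h q))) ≤
        δ q q' := by
    intro q q' hne h1 h2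
    rcases hδ q q' hne with h3 | ⟨h3, h4, h5⟩
    · exact h3
    · exfalso
      rcases Nat.lt_or_gt_of_ne h4 with h6 | h6
      · exact h2 ⟨h6, h3, by rw [← hsymm]; omega⟩
      · exact h1 ⟨h6, h3.symm, by omega⟩
  have hnonneg₂ : ∀ q q', ¬ anc q q' → ¬ anc q' q → 0 ≤ Δ₂ q q' := by
    intro q q' h1 h2
    by_cases hne : q = q'
    · simp [hΔ₂, hne]
    · simp only [hΔ₂, if_neg hne]
      exact sub_nonneg.2 (hmono _ _ (by omega) (hnonanc q q' hne h1 h2))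
  -- The negative term `-g (2 + h q - h q')` is absorbed by `g (h q + h q')`, as `1 ≤ h q'`; the
  -- terms `g (h q - h q')` cancel.
  have hanc : ∀ q q', anc q q' → 0 ≤ Δ₁ q (s q' - h q') + Δ₂ q q' := by
    rintro q q' ⟨h1, h2, h3⟩
    have hne : q ≠ q' := by
      rintro rfl
      omega
    have := hpos q'
    have := hhs q
    simp only [hΔ₁, hΔ₂, if_neg hne]
    have e1 : δ q q' =
        1 + ((s q' - h q' - (s q + 1 - h q)) + (s q + 1 - h q - (s q' - h q'))) := by omega
    have e2 := hmono (2 + ((s q + 1 - h q - (s q' + 1 - h q')) +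
      (s q' + 1 - h q' - (s q + 1 - h q))))
      (h q + ((s q' - h q' - s q) + (s q - (s q' - h q')))) (by omega) (by omega)
    rw [← e1]
    linarith
  -- The indices `s q' - h q'` of the ancestors are distinct and differ from `s q - h q`, since
  -- ancestors have heights below `h q`. The term at `s q - h q` is therefore left over.
  have hS : ∀ q, Δ₁ q (s q - h q) ≤ (∑ k ∈ Finset.range (D + 1), Δ₁ q k) +
      ∑ q', if anc q q' then Δ₂ q q' else 0 := by
    intro q
    have hinj : Set.InjOn (fun q' => s q' - h q')
        (Finset.univ.filter fun q' => anc q q' : Finset ι) := by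
      intro q₁ h₁ q₂ h₂ heq
      simp only [Finset.coe_filter, Finset.mem_univ, true_and, Set.mem_ofPred_eq] at h₁ h₂
      obtain ⟨a1, a2, a3⟩ := h₁
      obtain ⟨b1, b2, b3⟩ := h₂
      have := hhs q₁
      have := hhs q₂
      dsimp only at heq
      exact huniq q q₁ q₂ a2 b2 (by omega) a1 a3 (by omega)
    have hnot : s q - h q ∉ (Finset.univ.filter fun q' => anc q q').image
        (fun q' => s q' - h q') := by
      simp only [Finset.mem_image, Finset.mem_filter, Finset.mem_univ, true_and, not_exists,
        not_and]
      rintro q' ⟨a1, a2, a3⟩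
      have := hhs q
      omega
    have hsub : insert (s q - h q) ((Finset.univ.filter fun q' => anc q q').image
        (fun q' => s q' - h q')) ⊆ Finset.range (D + 1) := by
      intro k hk
      simp only [Finset.mem_insert, Finset.mem_image] at hk
      rw [Finset.mem_range]
      rcases hk with rfl | ⟨q', -, rfl⟩
      · have := hsD q
        omega
      · have := hsD q'
        omega
    have h1 := Finset.sum_le_sum_of_subset_of_nonneg (f := Δ₁ q) hsub fun k _ _ => hnonneg₁ q k
    rw [Finset.sum_insert hnot, Finset.sum_image hinj] at h1
    rw [← Finset.sum_filter]
    have h2 : 0 ≤ ∑ q' with anc q q', (Δ₁ q (s q' - h q') + Δ₂ q q') :=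
      Finset.sum_nonneg fun q' hq' => hanc q q' (Finset.mem_filter.1 hq').2
    rw [Finset.sum_add_distrib] at h2
    linarith
  have hsplit : ∑ q, ∑ q', Δ₂ q q' = 2 * (∑ q, ∑ q', if anc q q' then Δ₂ q q' else 0) +
      ∑ q, ∑ q', if anc q q' ∨ anc q' q then 0 else Δ₂ q q' := by
    have h1 : ∀ q q', Δ₂ q q' = (if anc q q' then Δ₂ q q' else 0) +
        (if anc q' q then Δ₂ q' q else 0) + if anc q q' ∨ anc q' q then 0 else Δ₂ q q' := by
      intro q q'
      by_cases h1 : anc q q'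
      · have h2 : ¬ anc q' q := fun h2 => by
          have := h1.1
          have := h2.1
          omega
        simp [h1, h2]
      · by_cases h2 : anc q' q
        · simp [h1, h2, hsymm₂ q q']
        · simp [h1, h2]
    conv_lhs => enter [2, q, 2, q']; rw [h1 q q']
    simp only [Finset.sum_add_distrib]
    rw [two_mul]
    congr 2
    exact Finset.sum_comm
  have htotal : 2 * (∑ q, ∑ k ∈ Finset.range (D + 1), Δ₁ q k) + ∑ q, ∑ q', Δ₂ q q' =
      2 * (∑ q, ((∑ k ∈ Finset.range (D + 1), Δ₁ q k) +
        ∑ q', if anc q q' then Δ₂ q q' else 0)) +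
      ∑ q, ∑ q', if anc q q' ∨ anc q' q then 0 else Δ₂ q q' := by
    rw [hsplit, Finset.sum_add_distrib]
    ring
  have hrest : ∀ q q', 0 ≤ if anc q q' ∨ anc q' q then 0 else Δ₂ q q' := by
    intro q q'
    split_ifs with h1
    · exact le_rfl
    · exact hnonneg₂ q q' (fun h2 => h1 (.inl h2)) fun h2 => h1 (.inr h2)
  have hSnonneg : ∀ q, 0 ≤ (∑ k ∈ Finset.range (D + 1), Δ₁ q k) +
      ∑ q', if anc q q' then Δ₂ q q' else 0 := fun q => (hnonneg₁ q _).trans (hS q)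
  have hsum1 := Finset.sum_nonneg fun q (_ : q ∈ Finset.univ) => hSnonneg q
  have hsum2 := Finset.sum_nonneg fun q (_ : q ∈ Finset.univ) =>
    Finset.sum_nonneg fun q' (_ : q' ∈ Finset.univ) => hrest q q'
  rw [htotal]
  refine ⟨by linarith, fun hstrict heq => ?_⟩
  have hz1 := (Finset.sum_eq_zero_iff_of_nonneg fun q _ => hSnonneg q).1
    (by linarith : ∑ q, ((∑ k ∈ Finset.range (D + 1), Δ₁ q k) +
        ∑ q', if anc q q' then Δ₂ q q' else 0) = 0)
  have hz2 := (Finset.sum_eq_zero_iff_of_nonneg fun q _ =>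
    Finset.sum_nonneg fun q' (_ : q' ∈ Finset.univ) => hrest q q').1
    (by linarith : ∑ q, ∑ q', (if anc q q' ∨ anc q' q then 0 else Δ₂ q q') = 0)
  have hone : ∀ q, h q = 1 := by
    intro q
    have h1 := hS q
    rw [hz1 q (Finset.mem_univ _)] at h1
    have h2 := hnonneg₁ q (s q - h q)
    have h3 : g (h q + ((s q - h q - s q) + (s q - (s q - h q)))) =
        g (1 + ((s q - h q - (s q + 1 - h q)) + (s q + 1 - h q - (s q - h q)))) := by
      simp only [hΔ₁] at h1 h2
      linarith
    have := hhs q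
    have := hpos q
    have h4 := hstrict.injOn (Set.mem_Ici.2 (by omega)) (Set.mem_Ici.2 (by omega)) h3
    omega
  refine ⟨hone, fun q q' hne => ?_⟩
  have ha : ¬ anc q q' := fun h1 => by
    have := h1.1
    rw [hone, hone] at this
    omega
  have hb : ¬ anc q' q := fun h1 => by
    have := h1.1
    rw [hone, hone] at this
    omega
  have h1 := (Finset.sum_eq_zero_iff_of_nonneg fun q' _ => hrest q q').1
    (hz2 q (Finset.mem_univ _)) q' (Finset.mem_univ _)
  have h2 := hnonanc q q' hne ha hb
  rw [if_neg (by tauto)] at h1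
  simp only [hΔ₂, if_neg hne] at h1
  have h3 := hstrict.injOn (Set.mem_Ici.2 (by omega)) (Set.mem_Ici.2 (by omega))
    (sub_eq_zero.1 h1)
  have := hone q
  have := hone q'
  omega

end Comparison

end EccTree

/-! ### Eccentricities along a diametral path, and the matching. -/

namespace EccTree

variable {V : Type*} {T : SimpleGraph V}

theorem exists_diametral_geodesic [Finite V] (hT : T.IsTree) :
    ∃ (D : ℕ) (x : ℕ → V), IsGeodesicSeq T x D ∧ ∀ u w, T.dist u w ≤ D := by
  have := hT.connected.nonempty
  obtain ⟨p, hp⟩ := Finite.exists_max fun p : V × V => T.dist p.1 p.2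
  obtain ⟨x, -, -, hx⟩ := exists_isGeodesicSeq hT.connected p.1 p.2
  exact ⟨_, x, hx, fun u w => hp (u, w)⟩

theorem IsProj.height_le {x : ℕ → V} {D : ℕ} {w : V} {a : ℕ} (ha : IsProj T x D w a)
    (hD : ∀ u w, T.dist u w ≤ D) : T.dist w (x a) ≤ a ∧ T.dist w (x a) + a ≤ D := by
  have h1 := (ha.2 0 (Nat.zero_le _)).1 (Nat.zero_le _)
  have h2 := (ha.2 D le_rfl).2 ha.1
  have h3 := hD w (x 0)
  have h4 := hD w (x D)
  have := ha.1
  omega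

/-- The ends of the path give the lower bound. For the upper bound, go through the projection `x b`
of `u`, whose height is at most `min b (D - b)`. -/
theorem IsProj.eccent_eq (hT : T.IsTree) {x : ℕ → V} {D : ℕ} (hx : IsGeodesicSeq T x D)
    (hD : ∀ u w, T.dist u w ≤ D) {w : V} {a : ℕ} (ha : IsProj T x D w a) :
    T.eccent w = ((T.dist w (x a) + max a (D - a) : ℕ) : ℕ∞) := by
  have hcoe : ∀ u, T.edist w u = (T.dist w u : ℕ∞) := fun u =>
    ((hT.connected w u).coe_dist_eq_edist).symm
  have haD := ha.1
  apply le_antisymm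
  · rw [SimpleGraph.eccent_le_iff]
    intro u
    rw [hcoe, Nat.cast_le]
    obtain ⟨b, hb⟩ := exists_isProj hT hx u
    have h1 := hb.height_le hD
    have h2 := hT.connected.dist_triangle (u := w) (v := x b) (w := u)
    rw [T.dist_comm (u := x b)] at h2
    have h3 := ha.2 b hb.1
    have := hb.1
    omega
  · rcases le_total a (D - a) with h | h
    · rw [max_eq_right h]
      refine le_trans ?_ (SimpleGraph.edist_le_eccent (v := x D))
      rw [hcoe, Nat.cast_le]
      have := (ha.2 D le_rfl).2 ha.1
      omega
    · rw [max_eq_left h]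
      refine le_trans ?_ (SimpleGraph.edist_le_eccent (v := x 0))
      rw [hcoe, Nat.cast_le]
      have := (ha.2 0 (Nat.zero_le _)).1 (Nat.zero_le _)
      omega

theorem IsGeodesicSeq.isProj_self {x : ℕ → V} {D k : ℕ} (hx : IsGeodesicSeq T x D) (hk : k ≤ D) :
    IsProj T x D (x k) k := by
  refine ⟨hk, fun j hj => ⟨fun h => ?_, fun h => ?_⟩⟩
  · have := hx j k h hk
    rw [T.dist_self, T.dist_comm]
    omega
  · have := hx k j h hj
    rw [T.dist_self]
    omega

/-- A strictly increasing enumeration of all integers from `⌈D/2⌉` to `D` has no gaps. -/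
theorem eq_add_of_strictMonoOn {b : ℕ → ℕ} {l D : ℕ} (hb : StrictMonoOn b (Set.Icc 1 l))
    (hmem : ∀ j ∈ Set.Icc 1 l, D ≤ 2 * b j ∧ b j ≤ D)
    (hex : ∀ c, D ≤ 2 * c → c ≤ D → ∃ j ∈ Set.Icc 1 l, b j = c) :
    1 ≤ l ∧ D + 1 = b 1 + l ∧ D ≤ 2 * b 1 ∧ 2 * b 1 ≤ D + 1 ∧ ∀ j ∈ Set.Icc 1 l, b j + 1 = b 1 + j := by
  obtain ⟨j₀, hj₀, hbj₀⟩ := hex D (by omega) le_rfl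
  obtain ⟨j₁, hj₁, hbj₁⟩ := hex ((D + 1) / 2) (by omega) (by omega)
  simp only [Set.mem_Icc] at *
  have hstep : ∀ j, 1 ≤ j → j + 1 ≤ l → b (j + 1) = b j + 1 := by
    intro j hj hjl
    have h1 := hb (Set.mem_Icc.2 ⟨hj, by omega⟩) (Set.mem_Icc.2 ⟨by omega, hjl⟩)
      (Nat.lt_add_one j)
    have h2 := hmem j ⟨hj, by omega⟩
    have h3 := hmem (j + 1) ⟨by omega, hjl⟩
    obtain ⟨i, hi, hbi⟩ := hex (b j + 1) (by omega) (by omega)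
    have h4 : j < i := (hb.lt_iff_lt (Set.mem_Icc.2 ⟨hj, by omega⟩) (Set.mem_Icc.2 hi)).1 (by omega)
    have h5 := hb.monotoneOn (Set.mem_Icc.2 ⟨by omega, hjl⟩) (Set.mem_Icc.2 hi) h4
    omega
  have hall : ∀ j, 1 ≤ j → j ≤ l → b j + 1 = b 1 + j := by
    intro j hj
    induction j, hj using Nat.le_induction with
    | base => exact fun _ => rfl
    | succ j hj ih =>
      intro h
      have h1 := ih (by omega)
      have h2 := hstep j hj h
      omega
  have h1 := hall j₀ hj₀.1 hj₀.2
  have h2 := hall j₁ hj₁.1 hj₁.2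
  have h3 := hall l (by omega) le_rfl
  have h4 := hmem l ⟨by omega, le_rfl⟩
  exact ⟨by omega, by omega, (hmem 1 ⟨le_rfl, by omega⟩).1, by omega, fun j hj => hall j hj.1 hj.2⟩

/-- A tree with eccentric sequence `(r; m_2, …, m_l)` has a diametral path of `r + l` vertices, and
its vertices can be labelled by those of the caterpillar in such a way that path vertices correspond
to path vertices, and off-path vertices to pendent vertices of the same eccentricity. -/
theorem HasEccSeq.exists_equiv [Finite V] (hT : T.IsTree) {r l : ℕ} {m : ℕ → ℕ} (hS : HasEccSeq T r l m) :
    ∃ (x : ℕ → V) (ψ : StdVertex r l m ≃ V) (a h : (Σ j : Finset.Icc 2 l, Fin (m j - 2)) → ℕ),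
      1 ≤ l ∧ IsGeodesicSeq T x (r + l - 1) ∧ (∀ k, ψ (.inl k) = x k) ∧
      ∀ q, IsProj T x (r + l - 1) (ψ (.inr q)) (a q) ∧ T.dist (ψ (.inr q)) (x (a q)) = h q ∧
        1 ≤ h q ∧ h q ≤ a q ∧ h q + a q ≤ r + l - 1 ∧
        attach q = min (a q) (r + l - 1 - a q) + 1 - h q := by
  obtain ⟨b, hb, hrange, hb1, hm⟩ := hS
  obtain ⟨D, x, hx, hD⟩ := exists_diametral_geodesic hT
  choose a ha using exists_isProj hT hx
  obtain ⟨E, hEdef⟩ : ∃ E : V → ℕ, ∀ w, E w = T.dist w (x (a w)) + max (a w) (D - a w) :=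
    ⟨_, fun _ => rfl⟩
  have hE : ∀ w, T.eccent w = (E w : ℕ∞) := fun w => by
    rw [hEdef, (ha w).eccent_eq hT hx hD]
  have hExk : ∀ k, k ≤ D → E (x k) = max k (D - k) := by
    intro k hk
    have h1 := (hx.isProj_self hk).eccent_eq hT hx hD
    rw [hE, T.dist_self, Nat.cast_inj] at h1
    omega
  have hEle : ∀ w, D ≤ 2 * E w ∧ E w ≤ D := by
    intro w
    have := (ha w).height_le hD
    have := hEdef w
    omega
  have hbE : ∀ j ∈ Set.Icc 1 l, ∃ w, E w = b j := by
    intro j hj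
    have : ((b j : ℕ) : ℕ∞) ∈ Set.range T.eccent := by
      rw [← hrange]
      exact ⟨j, hj, rfl⟩
    obtain ⟨w, hw⟩ := this
    exact ⟨w, by rwa [hE, Nat.cast_inj] at hw⟩
  have hEb : ∀ w, ∃ j ∈ Set.Icc 1 l, b j = E w := by
    intro w
    have : T.eccent w ∈ (fun j => (b j : ℕ∞)) '' Set.Icc 1 l := by
      rw [hrange]
      exact ⟨w, rfl⟩
    obtain ⟨j, hj, hw⟩ := this
    exact ⟨j, hj, by simpa [hE] using hw⟩
  obtain ⟨hl, hDl, hDr, hrD, hbj⟩ := eq_add_of_strictMonoOn (D := D) hb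
    (fun j hj => by
      obtain ⟨w, hw⟩ := hbE j hj
      rw [← hw]
      exact hEle w)
    (fun c h1 h2 => by
      obtain ⟨j, hj, hw⟩ := hEb (x c)
      refine ⟨j, hj, ?_⟩
      rw [hw, hExk c h2]
      omega)
  rw [hb1] at hDl hDr hrD hbj
  obtain rfl : D = r + l - 1 := by omega
  have hxinj : ∀ i j, i ≤ r + l - 1 → j ≤ r + l - 1 → x i = x j → i = j := by
    intro i j hi hj hij
    rcases le_total i j with h | h
    · have := hx i j h hj
      rw [hij, T.dist_self] at this
      omega
    · have := hx j i h hi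
      rw [hij, T.dist_self] at this
      omega
  let P : V → Prop := fun w => ∃ k : Fin (r + l), x k = w
  have hpos : ∀ w, ¬ P w → 1 ≤ T.dist w (x (a w)) := by
    intro w hw
    by_contra h
    have h0 : T.dist w (x (a w)) = 0 := by omega
    have := (ha w).1
    exact hw ⟨⟨a w, by omega⟩, ((hT.connected.dist_eq_zero_iff).1 h0).symm⟩
  -- An off-path vertex has positive height, so its eccentricity exceeds `⌈D/2⌉ = r`.
  have hmemJ : ∀ w : {w // ¬ P w}, E w.1 + 1 - r ∈ Finset.Icc 2 l := by
    intro w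
    have h1 := hpos w.1 w.2
    have h2 := hEle w.1
    have h3 := hEdef w.1
    have h4 := (ha w.1).1
    rw [Finset.mem_Icc]
    omega
  let f : {w // ¬ P w} → Finset.Icc 2 l := fun w => ⟨E w.1 + 1 - r, hmemJ w⟩
  have hfib : ∀ j : Finset.Icc 2 l, Nat.card {w // f w = j} = m j - 2 := by
    intro j
    have hj := Finset.mem_Icc.1 j.2
    have hbjj := hbj j ⟨by omega, hj.2⟩
    obtain ⟨c, hc⟩ : ∃ c, c = b j := ⟨_, rfl⟩
    -- Since `c > r ≥ D/2`, the path vertices of eccentricity `c` are exactly the two distinct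
    -- vertices `x c` and `x (D - c)`.
    have hne : x c ≠ x (r + l - 1 - c) := by
      intro h
      have := hxinj _ _ (by omega) (by omega) h
      omega
    have hEc := hExk c (by omega)
    have hEc' := hExk (r + l - 1 - c) (by omega)
    have hsub : ({x c, x (r + l - 1 - c)} : Set V) ⊆ {v | T.eccent v = b j} := by
      intro v hv
      rcases hv with rfl | rfl
      · change T.eccent _ = _
        rw [hE, Nat.cast_inj]
        omega
      · change T.eccent _ = _
        rw [hE, Nat.cast_inj]
        omega
    have hcard := Set.ncard_sdiff hsub (Set.toFinite _)
    rw [Set.ncard_pair hne, hm j ⟨hj.1, hj.2⟩] at hcard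
    rw [← hcard, ← Nat.card_coe_set_eq]
    refine Nat.card_congr ⟨fun w => ⟨w.1.1, ?_⟩, fun v => ⟨⟨v.1, ?_⟩, ?_⟩, fun _ => rfl,
      fun _ => rfl⟩
    · have h1 : E w.1.1 + 1 - r = j := congrArg Subtype.val w.2
      refine ⟨?_, ?_⟩
      · change T.eccent _ = _
        rw [hE, Nat.cast_inj]
        omega
      · rintro (h2 | h2)
        · exact w.1.2 ⟨⟨c, by omega⟩, h2.symm⟩
        · exact w.1.2 ⟨⟨r + l - 1 - c, by omega⟩, h2.symm⟩
    · rintro ⟨k, hk⟩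
      have h1 : T.eccent v.1 = b j := v.2.1
      have h2 := hExk k (by omega)
      rw [hE, Nat.cast_inj] at h1
      rw [hk] at h2
      refine v.2.2 ?_
      rw [← hk]
      rcases le_total (k : ℕ) (r + l - 1 - k) with h3 | h3
      · right
        change x k = x _
        congr 1
        omega
      · left
        congr 1
        omega
    · have h1 : T.eccent v.1 = b j := v.2.1
      rw [hE, Nat.cast_inj] at h1
      apply Subtype.ext
      change E v.1 + 1 - r = j
      omega
  classical
  have hxP : Function.Injective fun k : Fin (r + l) => x k := fun i j hij =>
    Fin.ext (hxinj _ _ (by omega) (by omega) hij)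
  let eP : Fin (r + l) ≃ {w // P w} := Equiv.ofInjective (fun k : Fin (r + l) => x k) hxP
  let eQ : (Σ j : Finset.Icc 2 l, Fin (m j - 2)) ≃ {w // ¬ P w} :=
    (Equiv.sigmaCongrRight fun j => (Finite.equivFinOfCardEq (hfib j)).symm).trans
      (Equiv.sigmaFiberEquiv f)
  have heQ : ∀ q, E (eQ q).1 + 1 - r = q.1 := by
    intro q
    have : f (eQ q) = q.1 := ((Finite.equivFinOfCardEq (hfib q.1)).symm q.2).2
    exact congrArg Subtype.val this
  refine ⟨x, (Equiv.sumCongr eP eQ).trans (Equiv.sumCompl P), fun q => a (eQ q).1,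
    fun q => T.dist (eQ q).1 (x (a (eQ q).1)), hl, hx, fun k => rfl, fun q => ?_⟩
  have h1 := (ha (eQ q).1).height_le hD
  have h2 := hEdef (eQ q).1
  have h3 := heQ q
  have h4 := Finset.mem_Icc.1 q.1.2
  refine ⟨ha _, rfl, hpos _ (eQ q).2, h1.1, h1.2, ?_⟩
  unfold attach
  dsimp only
  omega

end EccTree

/-! ### Distances between off-path vertices, and the theorem. -/

namespace EccTree

section OffPath

variable {V : Type*} {T : SimpleGraph V}

theorem dist_eq_of_isProj_ne (hT : T.IsTree) {x : ℕ → V} {n : ℕ} (hx : IsGeodesicSeq T x n)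
    {w w' : V} {a a' : ℕ} (ha : IsProj T x n w a) (ha' : IsProj T x n w' a') (hne : a ≠ a') :
    T.dist w w' = T.dist w (x a) + T.dist w' (x a') + ((a - a') + (a' - a)) := by
  rcases Nat.lt_or_gt_of_ne hne with h | h
  · have := dist_eq_of_isProj_lt hT hx ha ha' h
    omega
  · have := dist_eq_of_isProj_lt hT hx ha' ha h
    rw [T.dist_comm] at this
    omega

/-- Two vertices off a path of a tree either are far apart, or lie on a common geodesic to that
path. -/
theorem dist_ge_or_of_isProj (hT : T.IsTree) {x : ℕ → V} {n : ℕ} (hx : IsGeodesicSeq T x n)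
    {w w' : V} {a a' : ℕ} (ha : IsProj T x n w a) (ha' : IsProj T x n w' a') (hne : w ≠ w')
    (h1 : 1 ≤ T.dist w (x a)) (h1' : 1 ≤ T.dist w' (x a')) :
    2 + ((a - a') + (a' - a)) + ((T.dist w (x a) - T.dist w' (x a')) +
      (T.dist w' (x a') - T.dist w (x a))) ≤ T.dist w w' ∨
    (a = a' ∧ T.dist w (x a) ≠ T.dist w' (x a') ∧
      T.dist w w' = (T.dist w (x a) - T.dist w' (x a')) +
        (T.dist w' (x a') - T.dist w (x a))) := by
  by_cases haa : a = a'
  · subst haa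
    -- By parity, a distance exceeding the height difference exceeds it by at least two.
    obtain ⟨c, hc⟩ := even_dist_add_dist_add_dist hT w w' (x a)
    have h2 := hT.connected.dist_triangle (u := w) (v := w') (w := x a)
    have h3 := hT.connected.dist_triangle (u := w') (v := w) (w := x a)
    rw [T.dist_comm (u := w') (v := w)] at h3
    have h4 := hT.connected.pos_dist_of_ne hne
    omega
  · left
    rw [dist_eq_of_isProj_ne hT hx ha ha' haa]
    omega

end OffPath

/-- The reflection `k ↦ D - k` lets each off-path vertex be folded to the nearer half separately, as
only its sum over the whole path matters. -/
theorem sum_range_reflect_dist (D a : ℕ) (ha : a ≤ D) (F : ℕ → ℝ) :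
    ∑ k ∈ Finset.range (D + 1), F ((k - a) + (a - k)) =
      ∑ k ∈ Finset.range (D + 1), F ((k - min a (D - a)) + (min a (D - a) - k)) := by
  rcases le_total a (D - a) with h | h
  · rw [min_eq_left h]
  · rw [min_eq_right h, ← Finset.sum_range_reflect]
    refine Finset.sum_congr rfl fun k hk => ?_
    have := Finset.mem_range.1 hk
    congr 1
    omega

theorem wienerType_stdCaterpillar_le {V : Type*} [Fintype V] {T : SimpleGraph V} (hT : T.IsTree)
    {r l : ℕ} {m : ℕ → ℕ} (hS : HasEccSeq T r l m) {g : ℕ → ℝ} (hg : MonotoneOn g (Set.Ici 1)) :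
    wienerType (stdCaterpillar r l m) g ≤ wienerType T g ∧
    (StrictMonoOn g (Set.Ici 1) →
      wienerType T g = wienerType (stdCaterpillar r l m) g →
        Nonempty (T ≃g stdCaterpillar r l m)) := by
  classical
  obtain ⟨x, ψ, a, h, hl, hx, hψ, hQ⟩ := hS.exists_equiv hT
  obtain ⟨D, hD⟩ : ∃ D, D = r + l - 1 := ⟨_, rfl⟩
  have hD1 : r + l = D + 1 := by omega
  simp only [← hD] at hx hQ
  obtain ⟨s, hs⟩ : ∃ s : (Σ j : Finset.Icc 2 l, Fin (m j - 2)) → ℕ,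
    ∀ q, s q = min (a q) (D - a q) := ⟨_, fun _ => rfl⟩
  have hatt : ∀ q, attach q = s q + 1 - h q := fun q => by
    rw [hs]
    exact (hQ q).2.2.2.2.2
  have hproj := fun q => (hQ q).1
  have hh := fun q => (hQ q).2.1
  have hpos := fun q => (hQ q).2.2.1
  have hha := fun q => (hQ q).2.2.2.1
  have hhD := fun q => (hQ q).2.2.2.2.1
  have dPQ : ∀ (k : Fin (r + l)) q,
      T.dist (ψ (.inl k)) (ψ (.inr q)) = h q + ((k - a q : ℕ) + (a q - k : ℕ)) := by
    intro k q
    rw [hψ, T.dist_comm]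
    have := (hproj q).2 k (by omega)
    rw [hh] at this
    omega
  have dPP : ∀ k k' : Fin (r + l),
      T.dist (ψ (.inl k)) (ψ (.inl k')) = (k - k' : ℕ) + (k' - k : ℕ) := by
    intro k k'
    rw [hψ, hψ]
    rcases le_total (k : ℕ) k' with h | h
    · have := hx k k' h (by omega)
      omega
    · have := hx k' k h (by omega)
      rw [T.dist_comm]
      omega
  have hδ : ∀ q q', q ≠ q' → _ := fun q q' hne =>
    dist_ge_or_of_isProj hT hx (hproj q) (hproj q')
      (fun e => hne (Sum.inr_injective (ψ.injective e))) (by rw [hh]; exact hpos q)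
      (by rw [hh]; exact hpos q')
  simp only [hh] at hδ
  have hcomp := sum_dist_comparison D s h (fun q q' => T.dist (ψ (.inr q)) (ψ (.inr q'))) g hg
    hpos (fun q => by have := hs q; have := hha q; have := hhD q; omega)
    (fun q => by have := hs q; omega) (fun q q' => T.dist_comm)
    -- Folding `a` to `s` does not increase differences of indices, so the lower bound survives.
    (fun q q' hne => by
      have h1 := hs q
      have h2 := hs q'
      have h3 := hha q
      have h4 := hhD q
      have h5 := hha q'
      have h6 := hhD q'
      have h7 := hpos q
      have h8 := hpos q'
      rcases hδ q q' hne with h9 | ⟨h9, h10, h11⟩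
      · left
        omega
      · right
        refine ⟨?_, h10, h11⟩
        rw [h1, h2, h9])
    (fun q q' q'' _ _ hhh hlt h1 h2 => by
      have hbetw : ∀ p, h p < h q → T.dist (ψ (.inr q)) (ψ (.inr p)) = h q - h p →
          T.dist (ψ (.inr q)) (ψ (.inr p)) + T.dist (ψ (.inr p)) (x (a q)) =
            T.dist (ψ (.inr q)) (x (a q)) := by
        intro p hp hd
        have hne : q ≠ p := by
          rintro rfl
          omega
        rcases hδ q p hne with h9 | ⟨h9, -, -⟩
        · omega
        · rw [h9, hh p, ← h9, hh q, hd]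
          omega
      exact Sum.inr_injective (ψ.injective (eq_of_dist_eq_of_between hT (hbetw q' hlt h1)
        (hbetw q'' (by omega) (by omega)) (by omega))))
  have hdiff : 2 * (wienerType T g - wienerType (stdCaterpillar r l m) g) =
      2 * (∑ q, ∑ k ∈ Finset.range (D + 1), (g (h q + ((k - s q) + (s q - k))) -
        g (1 + ((k - (s q + 1 - h q)) + (s q + 1 - h q - k))))) +
      ∑ q, ∑ q', (if q = q' then 0 else g (T.dist (ψ (.inr q)) (ψ (.inr q'))) -
        g (2 + ((s q + 1 - h q - (s q' + 1 - h q')) +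
          (s q' + 1 - h q' - (s q + 1 - h q))))) := by
    have e1 : ∀ q, ∑ k ∈ Finset.range (D + 1), (g (h q + ((k - s q) + (s q - k))) -
        g (1 + ((k - (s q + 1 - h q)) + (s q + 1 - h q - k)))) =
        ∑ k : Fin (r + l), (g (T.dist (ψ (.inl k)) (ψ (.inr q))) -
          g (catDist (m := m) (.inl k) (.inr q))) := by
      intro q
      rw [Finset.sum_sub_distrib, Finset.sum_sub_distrib, hs,
        ← sum_range_reflect_dist D (a q) (hproj q).1 (fun t => g (h q + t)), ← hs, ← hD1,
        Finset.sum_range, Finset.sum_range]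
      simp only [dPQ, catDist, hatt]
    have e2 : ∀ q q', (if q = q' then 0 else g (T.dist (ψ (.inr q)) (ψ (.inr q'))) -
        g (2 + ((s q + 1 - h q - (s q' + 1 - h q')) +
          (s q' + 1 - h q' - (s q + 1 - h q))))) =
        (if q = q' then 0 else g (T.dist (ψ (.inr q)) (ψ (.inr q')))) -
          if q = q' then 0 else g (catDist (r := r) (.inr q) (.inr q')) := by
      intro q q'
      split_ifs with hqq
      · simp
      · simp only [catDist, hatt, if_neg hqq]
    rw [mul_sub, two_mul_wienerType_of_equiv T g ψ, two_mul_wienerType]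
    simp only [Fintype.sum_sum_type, e1, e2, dist_stdCaterpillar, Finset.sum_sub_distrib,
      Finset.sum_add_distrib, dPP, reduceCtorEq, if_false, Sum.inl.injEq, Sum.inr.injEq]
    have c1 : ∀ q k, T.dist (ψ (.inr q)) (ψ (.inl k)) = T.dist (ψ (.inl k)) (ψ (.inr q)) :=
      fun q k => T.dist_comm
    have c2 : ∀ q (k : Fin (r + l)), catDist (m := m) (.inr q) (.inl k) =
      catDist (.inl k) (.inr q) := fun q k => rfl
    simp only [c1, c2]
    rw [Finset.sum_comm (γ := Fin (r + l)) (f := fun k q => g (T.dist (ψ (.inl k)) (ψ (.inr q)))),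
      Finset.sum_comm (γ := Fin (r + l)) (f := fun k q => g (catDist (m := m) (.inl k) (.inr q)))]
    simp only [catDist]
    ring
  rw [← hdiff] at hcomp
  refine ⟨by linarith [hcomp.1], fun hstrict heq => ?_⟩
  obtain ⟨hone, hdd⟩ := hcomp.2 hstrict (by rw [heq]; ring)
  have hiso : ∀ φ : StdVertex r l m ≃ V, (∀ u v, T.dist (φ u) (φ v) = catDist u v) →
      Nonempty (T ≃g stdCaterpillar r l m) := by
    intro φ hφ
    refine ⟨RelIso.symm ⟨φ, ?_⟩⟩
    intro u v
    rw [← SimpleGraph.dist_eq_one_iff_adj, ← SimpleGraph.dist_eq_one_iff_adj, hφ,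
      dist_stdCaterpillar]
  have hQQ : ∀ q q', T.dist (ψ (.inr q)) (ψ (.inr q')) = catDist (r := r) (.inr q) (.inr q') := by
    intro q q'
    simp only [catDist, hatt, hone]
    split_ifs with hqq
    · rw [hqq, T.dist_self]
    · exact hdd q q' hqq
  -- Two pendent vertices on opposite sides would be at distance `2 + (D - s q - s q')`, which is
  -- more than `2 + |s q - s q'|`.
  have hside : (∀ q, a q = s q) ∨ ∀ q, a q = D - s q := by
    by_contra hcon
    push Not at hcon
    obtain ⟨⟨q, hq⟩, ⟨q', hq'⟩⟩ := hcon
    have h1 := hs q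
    have h2 := hs q'
    have h3 := (hproj q).1
    have h4 := (hproj q').1
    have hne : q ≠ q' := by
      rintro rfl
      omega
    have h5 := hdd q q' hne
    rw [dist_eq_of_isProj_ne hT hx (hproj q) (hproj q') (by omega), hh, hh, hone, hone] at h5
    omega
  rcases hside with hside | hside
  · refine hiso ψ ?_
    rintro (k | q) (k' | q')
    · exact dPP k k'
    · rw [dPQ, hone, hside]
      simp only [catDist, hatt, hone, Nat.add_sub_cancel]
    · rw [T.dist_comm, dPQ, hone, hside]
      simp only [catDist, hatt, hone, Nat.add_sub_cancel]
    · exact hQQ q q'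
  -- All pendent vertices sit on the far half here, so the path is reversed.
  · refine hiso ((Equiv.sumCongr Fin.revPerm (Equiv.refl _)).trans ψ) ?_
    have hrev : ∀ (k : Fin (r + l)) q, ((Fin.rev k : ℕ) - a q) + (a q - (Fin.rev k : ℕ)) =
        (k - s q : ℕ) + (s q - k : ℕ) := by
      intro k q
      have h1 := hside q
      have h2 := (hproj q).1
      have h3 := hs q
      rw [Fin.val_rev]
      omega
    rintro (k | q) (k' | q')
    · change T.dist (ψ (.inl k.rev)) (ψ (.inl k'.rev)) = _
      rw [dPP]
      simp only [catDist, Fin.val_rev]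
      omega
    · change T.dist (ψ (.inl k.rev)) (ψ (.inr q')) = _
      rw [dPQ, hone, hrev]
      simp only [catDist, hatt, hone, Nat.add_sub_cancel]
    · change T.dist (ψ (.inr q)) (ψ (.inl k'.rev)) = _
      rw [T.dist_comm, dPQ, hone, hrev]
      simp only [catDist, hatt, hone, Nat.add_sub_cancel]
    · exact hQQ q q'

theorem dist_map_le {V W : Type*} {G : SimpleGraph V} {H : SimpleGraph W} (f : G →g H) {u v : V}
    (h : G.Reachable u v) : H.dist (f u) (f v) ≤ G.dist u v := by
  obtain ⟨p, hp⟩ := h.exists_walk_length_eq_dist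
  rw [← hp, ← SimpleGraph.Walk.length_map f p]
  exact SimpleGraph.dist_le _

theorem wienerType_eq_of_iso {V W : Type*} [Fintype V] [Fintype W] {G : SimpleGraph V}
    {H : SimpleGraph W} (hG : G.Connected) (e : G ≃g H) (g : ℕ → ℝ) :
    wienerType G g = wienerType H g := by
  have hd : ∀ u v, H.dist (e u) (e v) = G.dist u v := by
    intro u v
    refine le_antisymm (dist_map_le e.toHom (hG u v)) ?_
    have := dist_map_le e.symm.toHom ((hG u v).map e.toHom)
    simpa using this
  have h := two_mul_wienerType_of_equiv H g e.toEquiv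
  have h' := two_mul_wienerType G g
  simp only [RelIso.coe_fn_toEquiv, hd] at h
  linarith

end EccTree

theorem theorem2 {V : Type*} [Fintype V] (T : SimpleGraph V) (hT : T.IsTree)
    (r l : ℕ) (m : ℕ → ℕ) (hS : EccTree.HasEccSeq T r l m)
    (g : ℕ → ℝ) (hg : ∀ x ∈ Set.Ici 1, 0 ≤ g x) :
    (MonotoneOn g (Set.Ici 1) →
      EccTree.wienerType T g ≥ EccTree.wienerType (EccTree.stdCaterpillar r l m) g ∧
      (StrictMonoOn g (Set.Ici 1) →
        (EccTree.wienerType T g = EccTree.wienerType (EccTree.stdCaterpillar r l m) g ↔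
          Nonempty (T ≃g EccTree.stdCaterpillar r l m)))) ∧
    (AntitoneOn g (Set.Ici 1) →
      EccTree.wienerType T g ≤ EccTree.wienerType (EccTree.stdCaterpillar r l m) g ∧
      (StrictAntiOn g (Set.Ici 1) →
        (EccTree.wienerType T g = EccTree.wienerType (EccTree.stdCaterpillar r l m) g ↔
          Nonempty (T ≃g EccTree.stdCaterpillar r l m)))) := by
  refine ⟨fun hmono => ?_, fun hanti => ?_⟩
  · obtain ⟨h1, h2⟩ := EccTree.wienerType_stdCaterpillar_le hT hS hmono
    exact ⟨h1, fun hstrict => ⟨h2 hstrict, fun ⟨e⟩ => EccTree.wienerType_eq_of_iso hT.connected e g⟩⟩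
  · obtain ⟨h1, h2⟩ := EccTree.wienerType_stdCaterpillar_le hT hS (g := fun n => -g n)
      fun _ hx _ hy hxy => neg_le_neg (hanti hx hy hxy)
    rw [EccTree.wienerType_neg, EccTree.wienerType_neg] at h1 h2
    refine ⟨neg_le_neg_iff.1 h1, fun hstrict => ⟨fun heq => ?_, fun ⟨e⟩ =>
      EccTree.wienerType_eq_of_iso hT.connected e g⟩⟩
    exact h2 (fun _ hx _ hy hxy => neg_lt_neg (hstrict hx hy hxy)) (by rw [heq])
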